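/- Let $k$ be a field and let $R$ be a local ring with maximal ideal $\mathfrak m$ that is essentially of finite type over $k$ (that is, $R$ is a localization of a finitely generated $k$-algebra). Let $e=\dim_{R/\mathfrak m}\mathfrak m/\mathfrak m^2$ be the embedding dimension of $R$, and for an ideal $\mathfrak a$ let $\ell(R/\mathfrak a)$ denote the length of the $R$-module $R/\mathfrak a$. Then for any finite collection $\mathfrak a_1,\dots,\mathfrak a_d\subset R$ ($d\ge 1$) of $\mathfrak m$-primary ideals, the lengths $\ell(R/\mathfrak a_i)$ and $\ell\bigl(R/(\mathfrak a_1\cdots\mathfrak a_d)\bigr)$ are finite, $$d^{\,e-1}\sum_{i=1}^d \ell(R/\mathfrak a_i)\ \ge\ \ell\bigl(R/(\mathfrak a_1\cdots\mathfrak a_d)\bigr),$$ and this inequality is strict if $d\ge 2$ and $e\ge 2$. -/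

import Mathlib

/-- The embedding dimension of a local ring `R` with maximal ideal `𝔪`: the dimension of `𝔪 / 𝔪²`
over the residue field `R / 𝔪`. (It is finite when `R` is Noetherian.) -/
noncomputable def embeddingDimension (R : Type*) [CommRing R] [IsLocalRing R] : ℕ :=
  Module.finrank (IsLocalRing.ResidueField R) (IsLocalRing.CotangentSpace R)

/-- An ideal `I` of a local ring `R` with maximal ideal `𝔪` is `𝔪`-primary: it is a primary ideal
(in particular proper) with radical `𝔪`. -/
def IsMaximalPrimary {R : Type*} [CommRing R] [IsLocalRing R] (I : Ideal R) : Prop :=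
  I.IsPrimary ∧ I.radical = IsLocalRing.maximalIdeal R

/-- The length `ℓ(R / I)` of the `R`-module `R / I`, an element of `ℕ∞`. -/
noncomputable def colength {R : Type*} [CommRing R] (I : Ideal R) : ℕ∞ :=
  Module.length R (R ⧸ I)

open Finsupp IsLocalRing

/-!
The inequality holds in every Noetherian local ring `R`; the hypothesis on `k` only serves to make
`R` Noetherian.

Let `x₁, …, xₑ` be a minimal system of generators of the maximal ideal and order the exponents
`u ∈ ℕᵉ` by the degree-lexicographic order. The monomials `x^u` need not be independent in any
sense, but one can still attach to an ideal `a` the set `leadingExponents x a` of all `u` such that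
`x^u` lies in `a` modulo the ideal generated by the monomials above `x^u`. Two facts carry the
reduction to combinatorics:

* Filter `R ⧸ a` by the ideals generated by the monomials above a given one. Each successive
  quotient is generated by one monomial and killed by the maximal ideal, so its length is `0` or
  `1`, and it is `0` exactly at the leading exponents. Hence, if `a` contains a power of the
  maximal ideal, the length of `R ⧸ a` is the number of exponents which are not leading
  (`finite_compl_leadingExponents_and_colength_eq`).
* Sums of leading exponents of ideals are leading exponents of their product
  (`sum_mem_leadingExponents`).

It remains to compare the sizes of the complements of upper sets `A₁, …, A_d ⊆ ℕⁿ⁺¹` and of an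
upper set `B` containing all sums `u₁ + ⋯ + u_d` with `uᵢ ∈ Aᵢ` (`ncard_compl_le_sum`). The
complement of an upper set is the region under a staircase over `ℕⁿ`; let `hᵢ` and `h` denote the
heights of these staircases. With indices `i = 0, …, d - 1`, every `v ∈ ℕⁿ` is the sum of the
vectors `⌊(v + i) / d⌋`, taken coordinatewise, so that `h(v) ≤ ∑ᵢ hᵢ(⌊(v + i) / d⌋)`. Summing over
`v` gives the inequality, because a value of `v ↦ ⌊(v + i) / d⌋` is taken at most `dⁿ` times. For
`i ≥ 1` and `n ≥ 1` the value `0` is taken less often than that, and `hᵢ(0) > 0` when `0 ∉ Aᵢ`,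
which makes the inequality strict.
-/

/-! ### Complements of upper sets of exponents -/

/-- The height over `w` of the staircase bounding the complement of `A`: the least `m` such that
`(m, w) ∈ A`. The value is the junk `0` if there is none, which cannot happen when `A` has finite
complement. -/
noncomputable def stairHeight {n : ℕ} (A : Set (Fin (n + 1) →₀ ℕ)) (w : Fin n →₀ ℕ) : ℕ :=
  sInf {m | cons m w ∈ A}

theorem cons_stairHeight_mem {n : ℕ} {A : Set (Fin (n + 1) →₀ ℕ)} (hA : Aᶜ.Finite)
    (w : Fin n →₀ ℕ) : cons (stairHeight A w) w ∈ A := by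
  refine Nat.sInf_mem (s := {m | cons m w ∈ A}) ?_
  by_contra h
  rw [Set.not_nonempty_iff_eq_empty, Set.eq_empty_iff_forall_notMem] at h
  refine Set.infinite_of_injective_forall_mem (f := fun m : ℕ => cons m w) ?_ h hA
  exact fun _ _ hab => (cons_injective2 hab).1

theorem lt_stairHeight_iff {n : ℕ} {A : Set (Fin (n + 1) →₀ ℕ)} (hA : Aᶜ.Finite)
    (hup : IsUpperSet A) (w : Fin n →₀ ℕ) (m : ℕ) : m < stairHeight A w ↔ cons m w ∉ A := by
  refine ⟨fun h => Nat.notMem_of_lt_sInf h, fun h => ?_⟩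
  by_contra! hle
  refine h (hup ?_ (cons_stairHeight_mem hA w))
  intro i
  refine Fin.cases ?_ (fun j => ?_) i <;> simp [hle]

/-- The complement of an upper set is counted by the columns under its staircase. -/
theorem sum_stairHeight {n : ℕ} {A : Set (Fin (n + 1) →₀ ℕ)} (hA : Aᶜ.Finite)
    (hup : IsUpperSet A) (W : Finset (Fin n →₀ ℕ)) (hW : ∀ u ∉ A, tail u ∈ W) :
    ∑ w ∈ W, stairHeight A w = Aᶜ.ncard := by
  classical
  rw [Set.ncard_eq_toFinset_card _ hA,
    Finset.card_eq_sum_card_fiberwise (f := tail) (t := W)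
      fun u hu => hW u (by simpa using hu)]
  refine Finset.sum_congr rfl fun w _ => ?_
  rw [← Finset.card_range (stairHeight A w)]
  refine Finset.card_bij' (fun m _ => cons m w) (fun u _ => u 0) ?_ ?_ ?_ ?_
  · intro m hm
    simpa using (lt_stairHeight_iff hA hup w m).1 (by simpa using hm)
  · intro u hu
    simp only [Finset.mem_filter, Set.Finite.mem_toFinset, Set.mem_compl_iff] at hu
    rw [Finset.mem_range, lt_stairHeight_iff hA hup, ← hu.2, cons_tail]
    exact hu.1
  · simp
  · intro u hu
    simp only [Finset.mem_filter] at hu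
    rw [← hu.2, cons_tail]

/-- The map `v ↦ ⌊(v + i) / d⌋`, taken in each coordinate. -/
noncomputable def shiftedQuotient {n : ℕ} (d i : ℕ) (v : Fin n →₀ ℕ) : Fin n →₀ ℕ :=
  Finsupp.equivFunOnFinite.symm fun j => (v j + i) / d

/-- Hermite's identity at `t / d`. -/
theorem sum_add_div (d : ℕ) (hd : 0 < d) (t : ℕ) : ∑ i : Fin d, (t + i) / d = t := by
  rw [Fin.sum_univ_eq_sum_range fun i => (t + i) / d]
  induction t with
  | zero => exact Finset.sum_eq_zero fun i hi => Nat.div_eq_of_lt (by simpa using hi)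
  | succ t ih =>
    -- Passing from `t` to `t + 1` trades the term `t / d` for `(t + d) / d = t / d + 1`.
    have h := (Finset.sum_range_succ (fun i => (t + i) / d) d).symm.trans
      (Finset.sum_range_succ' (fun i => (t + i) / d) d)
    rw [ih, Nat.add_div_right _ hd, add_zero] at h
    simp only [add_right_comm t 1, add_assoc t] at h ⊢
    omega

theorem sum_shiftedQuotient {n d : ℕ} (hd : 0 < d) (v : Fin n →₀ ℕ) :
    ∑ i : Fin d, shiftedQuotient d i v = v := by
  ext j
  simp [shiftedQuotient, sum_add_div d hd]

/-- Over `v`, the staircase of `B` is at most the sum of the staircases of the `A i` over any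
vectors that add up to `v`; the vectors used here differ by at most one in each coordinate. -/
theorem stairHeight_le_sum {n d : ℕ} (hd : 0 < d) {A : Fin d → Set (Fin (n + 1) →₀ ℕ)}
    (hA : ∀ i, (A i)ᶜ.Finite) {B : Set (Fin (n + 1) →₀ ℕ)}
    (hB : ∀ u : Fin d → Fin (n + 1) →₀ ℕ, (∀ i, u i ∈ A i) → ∑ i, u i ∈ B) (v : Fin n →₀ ℕ) :
    stairHeight B v ≤ ∑ i : Fin d, stairHeight (A i) (shiftedQuotient d i v) := by
  refine Nat.sInf_le ?_
  have h := hB _ fun i => cons_stairHeight_mem (hA i) (shiftedQuotient d i v)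
  suffices hcons : cons (∑ i : Fin d, stairHeight (A i) (shiftedQuotient d i v)) v =
      ∑ i : Fin d, cons (stairHeight (A i) (shiftedQuotient d i v)) (shiftedQuotient d i v) by
    rwa [Set.mem_ofPred_eq, hcons]
  ext j
  refine Fin.cases ?_ (fun j => ?_) j
  · simp
  · simpa using (DFunLike.congr_fun (sum_shiftedQuotient hd v) j).symm

/-- The pair formed by the quotients and the remainders of the coordinates of `v + (i, …, i)`
modulo `d`. -/
noncomputable def shiftedDivMod {n : ℕ} (d i : ℕ) [NeZero d] (v : Fin n →₀ ℕ) :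
    (Fin n →₀ ℕ) × (Fin n → Fin d) :=
  (shiftedQuotient d i v, fun j => Fin.ofNat d (v j + i))

theorem shiftedDivMod_injective {n : ℕ} (d i : ℕ) [NeZero d] :
    Function.Injective (shiftedDivMod (n := n) d i) := by
  intro v w h
  simp only [shiftedDivMod, Prod.mk.injEq] at h
  ext j
  have h1 : (v j + i) / d = (w j + i) / d := by
    simpa [shiftedQuotient] using DFunLike.congr_fun h.1 j
  have h2 : (v j + i) % d = (w j + i) % d := by
    simpa [Fin.ofNat] using congr_fun h.2 j
  have h3 := Nat.div_add_mod (v j + i) d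
  rw [h1, h2, Nat.div_add_mod] at h3
  omega

/-- Each value of `shiftedQuotient d i` is taken at most `d ^ n` times, once for each vector of
remainders. -/
theorem sum_comp_shiftedQuotient_le {n : ℕ} (d i : ℕ) [NeZero d] (h : (Fin n →₀ ℕ) → ℕ)
    (V W : Finset (Fin n →₀ ℕ)) (hW : ∀ w ∉ W, h w = 0) :
    ∑ v ∈ V, h (shiftedQuotient d i v) ≤ d ^ n * ∑ w ∈ W, h w := by
  classical
  calc ∑ v ∈ V, h (shiftedQuotient d i v)
      = ∑ p ∈ V.image (shiftedDivMod d i), h p.1 := by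
        rw [Finset.sum_image (shiftedDivMod_injective d i).injOn]
        rfl
    _ ≤ ∑ p ∈ W ×ˢ (Finset.univ : Finset (Fin n → Fin d)), h p.1 :=
        Finset.sum_le_sum_of_ne_zero fun p _ hp => by
          simpa using not_imp_comm.1 (hW p.1) hp
    _ = d ^ n * ∑ w ∈ W, h w := by
        simp [Finset.sum_product, Finset.mul_sum]

/-- For `0 < i` the value `0` of `shiftedQuotient d i` is taken fewer than `d ^ n` times, since
the remainders cannot all vanish there. -/
theorem sum_comp_shiftedQuotient_lt {n d i : ℕ} [NeZero d] (hn : 0 < n) (hi : 0 < i)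
    (h : (Fin n →₀ ℕ) → ℕ) (h0 : 0 < h 0)
    (V W : Finset (Fin n →₀ ℕ)) (hW : ∀ w ∉ W, h w = 0) :
    ∑ v ∈ V, h (shiftedQuotient d i v) < d ^ n * ∑ w ∈ W, h w := by
  classical
  have hmiss : ∀ v : Fin n →₀ ℕ, shiftedDivMod d i v ≠ (0, 0) := by
    intro v hv
    simp only [shiftedDivMod, Prod.mk.injEq] at hv
    have h1 : (v ⟨0, hn⟩ + i) / d = 0 := by
      simpa [shiftedQuotient] using DFunLike.congr_fun hv.1 ⟨0, hn⟩
    have h2 : (v ⟨0, hn⟩ + i) % d = 0 := by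
      simpa [Fin.ofNat, Fin.ext_iff] using congr_fun hv.2 ⟨0, hn⟩
    have h3 := Nat.div_add_mod (v ⟨0, hn⟩ + i) d
    rw [h1, h2] at h3
    omega
  have hmem : ((0, 0) : (Fin n →₀ ℕ) × (Fin n → Fin d)) ∈
      W ×ˢ (Finset.univ : Finset (Fin n → Fin d)) := by
    simpa using not_imp_comm.1 (hW 0) h0.ne'
  calc ∑ v ∈ V, h (shiftedQuotient d i v)
      = ∑ p ∈ V.image (shiftedDivMod d i), h p.1 := by
        rw [Finset.sum_image (shiftedDivMod_injective d i).injOn]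
        rfl
    _ ≤ ∑ p ∈ (W ×ˢ (Finset.univ : Finset (Fin n → Fin d))).erase (0, 0), h p.1 :=
        Finset.sum_le_sum_of_ne_zero fun p hp hp0 => by
          obtain ⟨v, -, rfl⟩ := Finset.mem_image.1 hp
          simpa [hmiss v] using not_imp_comm.1 (hW _) hp0
    _ < ∑ p ∈ W ×ˢ (Finset.univ : Finset (Fin n → Fin d)), h p.1 := by
        rw [← Finset.add_sum_erase _ _ hmem]
        exact Nat.lt_add_of_pos_left h0
    _ = d ^ n * ∑ w ∈ W, h w := by
        simp [Finset.sum_product, Finset.mul_sum]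

/-- The combinatorial form of the length inequality. -/
theorem ncard_compl_le_sum {n d : ℕ} (hd : 0 < d) {A : Fin d → Set (Fin (n + 1) →₀ ℕ)}
    (hA : ∀ i, (A i)ᶜ.Finite) (hAup : ∀ i, IsUpperSet (A i))
    {B : Set (Fin (n + 1) →₀ ℕ)} (hBfin : Bᶜ.Finite) (hBup : IsUpperSet B)
    (hB : ∀ u : Fin d → Fin (n + 1) →₀ ℕ, (∀ i, u i ∈ A i) → ∑ i, u i ∈ B) :
    Bᶜ.ncard ≤ d ^ n * ∑ i, (A i)ᶜ.ncard ∧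
      (2 ≤ d → 0 < n → (∀ i, 0 ∉ A i) → Bᶜ.ncard < d ^ n * ∑ i, (A i)ᶜ.ncard) := by
  classical
  have : NeZero d := ⟨hd.ne'⟩
  let V := hBfin.toFinset.image tail
  let W := fun i => (hA i).toFinset.image tail
  have hW : ∀ i, ∀ w ∉ W i, stairHeight (A i) w = 0 := by
    intro i w hw
    by_contra h
    refine hw (Finset.mem_image.2 ⟨cons 0 w, ?_, tail_cons _ _⟩)
    simpa using (lt_stairHeight_iff (hA i) (hAup i) w 0).1 (Nat.pos_of_ne_zero h)
  have hsum : Bᶜ.ncard ≤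
      ∑ i : Fin d, ∑ v ∈ V, stairHeight (A i) (shiftedQuotient d i v) := by
    rw [← sum_stairHeight hBfin hBup V fun u hu =>
      Finset.mem_image_of_mem _ (by simpa using hu), Finset.sum_comm]
    exact Finset.sum_le_sum fun v _ => stairHeight_le_sum hd hA hB v
  have hcard : ∀ i, (A i)ᶜ.ncard = ∑ w ∈ W i, stairHeight (A i) w := fun i =>
    (sum_stairHeight (hA i) (hAup i) (W i) fun u hu =>
      Finset.mem_image_of_mem _ (by simpa using hu)).symm
  have hle : ∀ i : Fin d, ∑ v ∈ V, stairHeight (A i) (shiftedQuotient d i v) ≤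
      d ^ n * (A i)ᶜ.ncard := fun i => by
    rw [hcard]
    exact sum_comp_shiftedQuotient_le d i _ V (W i) (hW i)
  rw [Finset.mul_sum]
  refine ⟨hsum.trans (Finset.sum_le_sum fun i _ => hle i), fun hd2 hn h0 => hsum.trans_lt ?_⟩
  refine Finset.sum_lt_sum (fun i _ => hle i) ⟨⟨1, hd2⟩, Finset.mem_univ _, ?_⟩
  rw [hcard]
  refine sum_comp_shiftedQuotient_lt hn one_pos _ ?_ V _ (hW _)
  rw [lt_stairHeight_iff (hA _) (hAup _), cons_zero_zero]
  exact h0 _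

/-! ### Lengths of quotients and leading exponents -/

/-- If the maximal ideal sends `f` into `J`, then adding `f` to `J` changes the colength by at most
one: the submodule of `R ⧸ J` generated by `f` is zero or isomorphic to the residue field. -/
theorem colength_eq_add {R : Type*} [CommRing R] [IsLocalRing R] {J : Ideal R} {f : R}
    (h : ∀ r ∈ maximalIdeal R, r * f ∈ J) [Decidable (f ∈ J)] :
    colength J = colength (J ⊔ Ideal.span {f}) + if f ∈ J then 0 else 1 := by
  split_ifs with hf
  · rw [sup_of_le_left ((Ideal.span_singleton_le_iff_mem J).2 hf), add_zero]
  let g : (R ⧸ maximalIdeal R) →ₗ[R] R ⧸ J :=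
    (maximalIdeal R).liftQ (LinearMap.toSpanSingleton R _ (Ideal.Quotient.mk J f)) fun r hr => by
      have : Ideal.Quotient.mk J (r * f) = 0 := Ideal.Quotient.eq_zero_iff_mem.2 (h r hr)
      rw [LinearMap.mem_ker, LinearMap.toSpanSingleton_apply, ← this]
      rfl
  have hgapp : ∀ r : R, g (Submodule.Quotient.mk r) = Ideal.Quotient.mk J (r * f) := fun r => rfl
  have hsimple : IsSimpleModule R (R ⧸ maximalIdeal R) :=
    isSimpleModule_iff_isCoatom.2 (maximalIdeal.isMaximal R).out
  have hg : Function.Injective g := by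
    refine (LinearMap.injective_or_eq_zero g).resolve_right fun h0 => hf ?_
    have := hgapp 1
    rw [h0, one_mul] at this
    exact Ideal.Quotient.eq_zero_iff_mem.1 this.symm
  have hle : J ≤ J ⊔ Ideal.span {f} := le_sup_left
  have key := Module.length_eq_add_of_exact g (Submodule.factor hle) hg
    (Submodule.factor_surjective hle) ?_
  · rw [colength, key, Module.length_eq_one, add_comm]
    rfl
  · intro y
    obtain ⟨y, rfl⟩ := Submodule.Quotient.mk_surjective _ y
    change (Submodule.Quotient.mk y : R ⧸ J ⊔ Ideal.span {f}) = 0 ↔ _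
    rw [Submodule.Quotient.mk_eq_zero]
    constructor
    · intro hy
      obtain ⟨j, hj, z, hz, rfl⟩ := Submodule.mem_sup.1 hy
      obtain ⟨r, rfl⟩ := Ideal.mem_span_singleton'.1 hz
      refine ⟨Submodule.Quotient.mk r, (hgapp r).trans (Ideal.Quotient.eq.2 ?_)⟩
      simpa using hj
    · rintro ⟨r, hr⟩
      obtain ⟨r, rfl⟩ := Submodule.Quotient.mk_surjective _ r
      have hmem : r * f - y ∈ J := Ideal.Quotient.eq.1 ((hgapp r).symm.trans hr)
      rw [← sub_sub_cancel (r * f) y]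
      exact sub_mem (Ideal.mem_sup_right (Ideal.mul_mem_left _ _ (Ideal.mem_span_singleton_self f)))
        (Ideal.mem_sup_left hmem)

section LeadingExponents

variable {R : Type*} [CommRing R] {e : ℕ}

/-- The value `x^u` in `R` of the monomial with exponent `u` at the family `x`. -/
def monomialAt (x : Fin e → R) (u : Fin e →₀ ℕ) : R := ∏ i, x i ^ u i

theorem monomialAt_add (x : Fin e → R) (u v : Fin e →₀ ℕ) :
    monomialAt x (u + v) = monomialAt x u * monomialAt x v := by
  simp [monomialAt, pow_add, Finset.prod_mul_distrib]

theorem monomialAt_zero (x : Fin e → R) : monomialAt x 0 = 1 := by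
  simp [monomialAt]

theorem monomialAt_single (x : Fin e → R) (i : Fin e) : monomialAt x (single i 1) = x i := by
  rw [monomialAt, Finset.prod_eq_single i] <;> simp +contextual [eq_comm]

theorem monomialAt_mem_pow {x : Fin e → R} {I : Ideal R} (hx : ∀ i, x i ∈ I) (u : Fin e →₀ ℕ) :
    monomialAt x u ∈ I ^ u.degree := by
  rw [degree_eq_sum, ← Finset.prod_pow_eq_pow_sum]
  exact Ideal.prod_mem_prod fun i _ => Ideal.pow_mem_pow (hx i) _

/-- The ideal generated by the monomials in `x` whose exponent is strictly above `u` in the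
degree-lexicographic order. -/
def higherIdeal (x : Fin e → R) (u : Fin e →₀ ℕ) : Ideal R :=
  Ideal.span (monomialAt x '' {v | toDegLex u < toDegLex v})

theorem monomialAt_mul_mem_higherIdeal {x : Fin e → R} {u : Fin e →₀ ℕ} (v : Fin e →₀ ℕ) {r : R}
    (hr : r ∈ higherIdeal x u) : monomialAt x v * r ∈ higherIdeal x (u + v) := by
  refine Submodule.span_induction (p := fun r _ => monomialAt x v * r ∈ higherIdeal x (u + v))
    ?_ ?_ ?_ ?_ hr
  · rintro _ ⟨w, hw, rfl⟩
    rw [← monomialAt_add, add_comm v]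
    refine Ideal.subset_span ⟨_, ?_, rfl⟩
    exact add_lt_add_left (α := DegLex (Fin e →₀ ℕ)) hw _
  · simp
  · intro r s _ _ hr hs
    rw [mul_add]
    exact add_mem hr hs
  · intro c r _ hr
    rw [smul_eq_mul, mul_left_comm]
    exact Ideal.mul_mem_left _ _ hr

/-- The exponents `u` such that `a` contains an element of the form `x^u - r` with `r` in the ideal
generated by the higher monomials. The name refers to the lowest monomial of an element, which is
its leading one in a local ring. As the monomials may satisfy relations, `u` also belongs to this
set when `x^u` itself lies in the ideal generated by the higher monomials. -/
def leadingExponents (x : Fin e → R) (a : Ideal R) : Set (Fin e →₀ ℕ) :=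
  {u | monomialAt x u ∈ a ⊔ higherIdeal x u}

theorem higherIdeal_mul_higherIdeal_le (x : Fin e → R) (u v : Fin e →₀ ℕ) :
    higherIdeal x u * higherIdeal x v ≤ higherIdeal x (u + v) := by
  rw [higherIdeal, higherIdeal, Ideal.span_mul_span', Ideal.span_le]
  rintro _ ⟨_, ⟨p, hp, rfl⟩, _, ⟨q, hq, rfl⟩, rfl⟩
  refine Ideal.subset_span ⟨p + q, ?_, monomialAt_add _ _ _⟩
  exact add_lt_add (α := DegLex (Fin e →₀ ℕ)) hp hq

theorem add_mem_leadingExponents {x : Fin e → R} {a b : Ideal R} {u v : Fin e →₀ ℕ}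
    (hu : u ∈ leadingExponents x a) (hv : v ∈ leadingExponents x b) :
    u + v ∈ leadingExponents x (a * b) := by
  obtain ⟨f, hf, p, hp, hfp⟩ := Submodule.mem_sup.1 hu
  obtain ⟨g, hg, q, hq, hgq⟩ := Submodule.mem_sup.1 hv
  refine Submodule.mem_sup.2 ⟨f * g, Ideal.mul_mem_mul hf hg,
    monomialAt x u * q + (monomialAt x v * p - p * q), ?_, ?_⟩
  · refine add_mem ?_ (sub_mem (monomialAt_mul_mem_higherIdeal v hp)
      (higherIdeal_mul_higherIdeal_le x u v (Ideal.mul_mem_mul hp hq)))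
    rw [add_comm u]
    exact monomialAt_mul_mem_higherIdeal u hq
  · rw [monomialAt_add, ← hfp, ← hgq]
    ring

theorem leadingExponents_top (x : Fin e → R) : leadingExponents x ⊤ = Set.univ := by
  simp [leadingExponents]

theorem isUpperSet_leadingExponents (x : Fin e → R) (a : Ideal R) :
    IsUpperSet (leadingExponents x a) := by
  intro u v huv hu
  -- Every exponent is leading for `⊤`, and `a * ⊤ = a`.
  rw [← add_tsub_cancel_of_le huv, ← Ideal.mul_top a]
  exact add_mem_leadingExponents hu (by simp [leadingExponents_top])

theorem sum_mem_leadingExponents {ι : Type*} {x : Fin e → R} {a : ι → Ideal R}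
    {u : ι → Fin e →₀ ℕ} (s : Finset ι) (hu : ∀ i ∈ s, u i ∈ leadingExponents x (a i)) :
    ∑ i ∈ s, u i ∈ leadingExponents x (∏ i ∈ s, a i) := by
  classical
  induction s using Finset.induction_on with
  | empty => simp [Ideal.one_eq_top, leadingExponents_top]
  | insert i s hi ih =>
    rw [Finset.sum_insert hi, Finset.prod_insert hi]
    exact add_mem_leadingExponents (hu i (by simp)) (ih fun j hj => hu j (by simp [hj]))

variable [IsLocalRing R]

open Classical in
/-- The colength of `a` after adding all monomials outside a finite initial segment `s` of the
exponents. Removing the largest exponent `u` of `s` adds one generator `x^u`, which the maximal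
ideal sends into the ideal generated by the monomials above `u`. -/
theorem colength_sup_span_compl {x : Fin e → R} (hx : Ideal.span (Set.range x) = maximalIdeal R)
    (a : Ideal R) (s : Finset (DegLex (Fin e →₀ ℕ))) :
    IsLowerSet (s : Set (DegLex (Fin e →₀ ℕ))) →
    colength (a ⊔ Ideal.span (monomialAt x '' {v | toDegLex v ∉ s})) =
      (s.filter fun u => ofDegLex u ∉ leadingExponents x a).card := by
  induction s using Finset.induction_on_max with
  | empty =>
    intro _
    have : a ⊔ Ideal.span (monomialAt x '' {v | toDegLex v ∉ (∅ : Finset _)}) = ⊤ := by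
      rw [Ideal.eq_top_iff_one]
      exact Ideal.mem_sup_right (Ideal.subset_span ⟨0, by simp, monomialAt_zero x⟩)
    rw [this, Finset.filter_empty, Finset.card_empty, colength, Nat.cast_zero,
      Module.length_eq_zero_iff]
    exact Ideal.Quotient.subsingleton_iff.2 rfl
  | insert u s hu ih =>
    intro hs
    have hus : u ∉ s := fun h => (hu u h).false
    have hmem : ∀ v, v ∉ insert u s ↔ u < v := by
      intro v
      refine ⟨fun hv => ?_, fun hv hv' => ?_⟩
      · by_contra! hle
        exact hv (hs hle (Finset.mem_insert_self u s))
      · rcases Finset.mem_insert.1 hv' with rfl | hv'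
        · exact hv.false
        · exact hv.not_gt (hu v hv')
    have hs' : IsLowerSet (s : Set (DegLex (Fin e →₀ ℕ))) := by
      intro v w hwv hv
      have := hs hwv (Finset.mem_insert_of_mem hv)
      exact (Finset.mem_insert.1 this).resolve_left fun h =>
        (hwv.trans_lt (hu v hv)).ne h
    have hhigher : Ideal.span (monomialAt x '' {v | toDegLex v ∉ insert u s}) =
        higherIdeal x (ofDegLex u) := by
      simp only [hmem]
      rfl
    have hspan : a ⊔ Ideal.span (monomialAt x '' {v | toDegLex v ∉ s}) =
        a ⊔ higherIdeal x (ofDegLex u) ⊔ Ideal.span {monomialAt x (ofDegLex u)} := by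
      rw [← hhigher, sup_assoc, ← Ideal.span_union, ← Set.image_singleton, ← Set.image_union]
      congr 3
      ext v
      simp only [Set.mem_ofPred_eq, Finset.mem_insert, Set.mem_union, Set.mem_singleton_iff]
      by_cases hv : toDegLex v = u
      · subst hv
        simpa using hus
      · have : v ≠ ofDegLex u := hv
        simp [hv, this]
    have hkill : ∀ r ∈ maximalIdeal R,
        r * monomialAt x (ofDegLex u) ∈ a ⊔ higherIdeal x (ofDegLex u) := by
      intro r hr
      refine Ideal.mem_sup_right ?_
      rw [← hx] at hr
      refine Submodule.span_induction
        (p := fun r _ => r * monomialAt x (ofDegLex u) ∈ higherIdeal x (ofDegLex u)) ?_ ?_ ?_ ?_ hr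
      · rintro _ ⟨i, rfl⟩
        rw [← monomialAt_single x i, ← monomialAt_add]
        refine Ideal.subset_span ⟨_, ?_, rfl⟩
        rw [Set.mem_ofPred_eq, toDegLex_ofDegLex, DegLex.lt_iff]
        left
        simp
      · simp
      · intro r s _ _ hr hs
        rw [add_mul]
        exact add_mem hr hs
      · intro c r _ hr
        rw [smul_eq_mul, mul_assoc]
        exact Ideal.mul_mem_left _ _ hr
    rw [hhigher, colength_eq_add hkill, ← hspan, ih hs', Finset.filter_insert]
    by_cases h : ofDegLex u ∈ leadingExponents x a
    · have h' := h
      rw [leadingExponents, Set.mem_ofPred_eq] at h'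
      simp [h, h']
    · have h' := h
      rw [leadingExponents, Set.mem_ofPred_eq] at h'
      rw [if_neg h', if_pos h, Finset.card_insert_of_notMem (by simp [hus])]
      simp

/-- The colength of an ideal containing a power of the maximal ideal counts the exponents that are
not leading. -/
theorem finite_compl_leadingExponents_and_colength_eq {x : Fin e → R}
    (hx : Ideal.span (Set.range x) = maximalIdeal R) {a : Ideal R} {N : ℕ}
    (hN : maximalIdeal R ^ N ≤ a) :
    (leadingExponents x a)ᶜ.Finite ∧ colength a = (leadingExponents x a)ᶜ.ncard := by
  classical
  have hmon : ∀ u : Fin e →₀ ℕ, N ≤ u.degree → monomialAt x u ∈ a := fun u hu =>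
    hN (Ideal.pow_le_pow_right hu
      (monomialAt_mem_pow (fun i => hx ▸ Ideal.subset_span (Set.mem_range_self i)) u))
  have hsub : (leadingExponents x a)ᶜ ⊆ {u | u.degree < N} := by
    intro u hu
    by_contra! h
    exact hu (Ideal.mem_sup_left (hmon u (by simpa using h)))
  have hfin : {u : Fin e →₀ ℕ | u.degree < N}.Finite := finite_of_degree_lt N
  refine ⟨hfin.subset hsub, ?_⟩
  -- The exponents of degree less than `N` form an initial segment, as the order is graded.
  let s : Finset (DegLex (Fin e →₀ ℕ)) := hfin.toFinset
  have hmem : ∀ v : DegLex (Fin e →₀ ℕ), v ∈ s ↔ (ofDegLex v).degree < N := fun v =>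
    hfin.mem_toFinset
  have hs : IsLowerSet (s : Set (DegLex (Fin e →₀ ℕ))) := fun v w hwv hv =>
    (hmem w).2 ((DegLex.monotone_degree hwv).trans_lt ((hmem v).1 hv))
  have hle : Ideal.span (monomialAt x '' {v | toDegLex v ∉ s}) ≤ a := by
    rw [Ideal.span_le]
    rintro _ ⟨v, hv, rfl⟩
    exact hmon v (not_lt.1 fun h => hv ((hmem _).2 h))
  have key := colength_sup_span_compl hx a s hs
  rw [sup_of_le_left hle] at key
  rw [key, Set.ncard_eq_toFinset_card _ (hfin.subset hsub)]
  congr 2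
  ext u
  rw [Finset.mem_filter, hmem]
  refine Iff.trans ?_ (Set.Finite.mem_toFinset (hfin.subset hsub)).symm
  exact ⟨fun h => h.2, fun h => ⟨hsub h, h⟩⟩

theorem exists_span_range_eq_maximalIdeal (R : Type*) [CommRing R] [IsLocalRing R]
    [IsNoetherianRing R] :
    ∃ x : Fin (embeddingDimension R) → R, Ideal.span (Set.range x) = maximalIdeal R := by
  obtain ⟨s, hs, hspan⟩ := Submodule.FG.exists_span_finset_card_eq_spanFinrank
    (maximalIdeal R).fg_of_isNoetherianRing
  replace hs : s.card = embeddingDimension R :=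
    hs.trans (spanFinrank_maximalIdeal_eq_finrank_cotangentSpace R)
  generalize embeddingDimension R = n at hs ⊢
  refine ⟨fun i => (s.equivFinOfCardEq hs).symm i, Eq.trans ?_ hspan⟩
  refine congrArg Ideal.span (Set.ext fun r => ⟨?_, fun hr => ?_⟩)
  · rintro ⟨i, rfl⟩
    exact ((s.equivFinOfCardEq hs).symm i).2
  · exact ⟨s.equivFinOfCardEq hs ⟨r, hr⟩, by simp⟩

theorem zero_notMem_leadingExponents {x : Fin e → R}
    (hx : Ideal.span (Set.range x) = maximalIdeal R) {a : Ideal R} (ha : a ≤ maximalIdeal R) :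
    0 ∉ leadingExponents x a := by
  intro h
  rw [leadingExponents, Set.mem_ofPred_eq, monomialAt_zero] at h
  have hle : higherIdeal x 0 ≤ maximalIdeal R := by
    rw [higherIdeal, Ideal.span_le]
    rintro _ ⟨v, hv, rfl⟩
    have hv0 : v.degree ≠ 0 := by
      rw [ne_eq, degree_eq_zero_iff]
      rintro rfl
      exact lt_irrefl (toDegLex (0 : Fin e →₀ ℕ)) hv
    exact Ideal.pow_le_self hv0
      (monomialAt_mem_pow (fun i => hx ▸ Ideal.subset_span (Set.mem_range_self i)) v)
  exact (Ideal.ne_top_iff_one _).1 (maximalIdeal.isMaximal R).ne_top (sup_le ha hle h)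

end LeadingExponents

/-! ### The length of a quotient by a product of ideals -/

theorem IsMaximalPrimary.exists_pow_le {R : Type*} [CommRing R] [IsLocalRing R]
    [IsNoetherianRing R] {a : Ideal R} (ha : IsMaximalPrimary a) :
    ∃ N, maximalIdeal R ^ N ≤ a := by
  rw [← ha.2]
  exact Ideal.exists_radical_pow_le_of_fg a a.radical.fg_of_isNoetherianRing

theorem IsMaximalPrimary.le_maximalIdeal {R : Type*} [CommRing R] [IsLocalRing R]
    {a : Ideal R} (ha : IsMaximalPrimary a) : a ≤ maximalIdeal R :=
  ha.2 ▸ Ideal.le_radical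

/-- The length inequality, and its strict form, over any Noetherian local ring. -/
theorem colength_prod_le {R : Type*} [CommRing R] [IsLocalRing R] [IsNoetherianRing R] {d : ℕ}
    (a : Fin d → Ideal R) (ha : ∀ i, IsMaximalPrimary (a i)) :
    (∀ i, colength (a i) ≠ ⊤) ∧ colength (∏ i, a i) ≠ ⊤ ∧
    ((colength (∏ i, a i)).toNat : ℚ) ≤
      (d : ℚ) ^ ((embeddingDimension R : ℤ) - 1) * ∑ i, ((colength (a i)).toNat : ℚ) ∧
    (2 ≤ d → 2 ≤ embeddingDimension R →
      ((colength (∏ i, a i)).toNat : ℚ) <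
        (d : ℚ) ^ ((embeddingDimension R : ℤ) - 1) * ∑ i, ((colength (a i)).toNat : ℚ)) := by
  obtain ⟨x, hx⟩ := exists_span_range_eq_maximalIdeal R
  choose N hN using fun i => (ha i).exists_pow_le
  have hNprod : maximalIdeal R ^ (∑ i, N i) ≤ ∏ i, a i := by
    rw [← Finset.prod_pow_eq_pow_sum]
    exact Finset.prod_le_prod' fun i _ => hN i
  have hA := fun i => finite_compl_leadingExponents_and_colength_eq hx (hN i)
  have hB := finite_compl_leadingExponents_and_colength_eq hx hNprod
  simp only [fun i => (hA i).2, hB.2, ENat.toNat_natCast, ne_eq, ENat.natCast_ne_top,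
    not_false_eq_true, implies_true, true_and]
  have h0 : ∀ i, 0 ∉ leadingExponents x (a i) := fun i =>
    zero_notMem_leadingExponents hx (ha i).le_maximalIdeal
  rcases Nat.eq_zero_or_pos d with rfl | hd
  · simp [Ideal.one_eq_top, leadingExponents_top]
  generalize embeddingDimension R = e at x hx hA hB h0 ⊢
  cases e with
  | zero =>
    -- Here `R` is a field and both sides of the inequality are equal to `1`; the exponent is `-1`.
    have hone : ∀ i, (leadingExponents x (a i))ᶜ.ncard = 1 := fun i => by
      rw [Set.ncard_eq_one]
      exact ⟨0, Set.eq_singleton_iff_unique_mem.2 ⟨h0 i, fun u _ => Subsingleton.elim u 0⟩⟩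
    have hprod : (leadingExponents x (∏ i, a i))ᶜ.ncard ≤ 1 := Set.ncard_le_one_of_subsingleton _
    have hd' : (d : ℚ) ≠ 0 := by exact_mod_cast hd.ne'
    simp only [hone]
    refine ⟨?_, fun _ h => by omega⟩
    simpa [hd'] using hprod
  | succ n =>
    obtain ⟨h1, h2⟩ := ncard_compl_le_sum hd (fun i => (hA i).1)
      (fun i => isUpperSet_leadingExponents x (a i)) hB.1
      (isUpperSet_leadingExponents x _)
      (fun u hu => sum_mem_leadingExponents Finset.univ fun i _ => hu i)
    rw [Nat.cast_succ, add_sub_cancel_right, zpow_natCast]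
    refine ⟨by exact_mod_cast h1, fun hd2 he => ?_⟩
    exact_mod_cast h2 hd2 (by omega) h0

theorem mainTheorem6 {k R : Type*} [Field k] [CommRing R] [IsLocalRing R] [Algebra k R]
    [Algebra.EssFiniteType k R] (d : ℕ) (a : Fin d → Ideal R)
    (ha : ∀ i, IsMaximalPrimary (a i)) :
    -- all the lengths are finite, so that `ENat.toNat` below is their true value
    (∀ i, colength (a i) ≠ ⊤) ∧ colength (∏ i, a i) ≠ ⊤ ∧
    ((colength (∏ i, a i)).toNat : ℚ) ≤
      (d : ℚ) ^ ((embeddingDimension R : ℤ) - 1) * ∑ i, ((colength (a i)).toNat : ℚ) ∧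
    (2 ≤ d → 2 ≤ embeddingDimension R →
      ((colength (∏ i, a i)).toNat : ℚ) <
        (d : ℚ) ^ ((embeddingDimension R : ℤ) - 1) * ∑ i, ((colength (a i)).toNat : ℚ)) := by
  have := Algebra.EssFiniteType.isNoetherianRing k R
  exact colength_prod_le a ha
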